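/- Let $Y_1,Y_2,\ldots$ be i.i.d. random variables with values in $\{0,1,2,\ldots\}$ and finite mean $\mu<1$, and write $\overline F(x)=P(Y_1>x)$. For an integer $u\ge 0$ let $U(t)=u+t-\sum_{i=1}^t Y_i$, $t=0,1,2,\ldots$, be the Gerber–Dickson risk process with initial capital $u$, let $\tau=\min\{t\ge 1: U(t)\le 0\}$ (with $\tau=\infty$ if there is no such $t$) and let $\psi(u)=P(\tau<\infty)$ be the ultimate ruin probability. Let $Z(t)=\sum_{i=1}^t(Y_i-1)$, let $\tau_0^*=0$ and, for $i\ge1$, $\tau_i^*=\min\{t>\tau_{i-1}^*: Z(t)\ge Z(\tau_{i-1}^*)\}$ (with $\tau_i^*=\infty$ if there is no such $t$ or if $\tau_{i-1}^*=\infty$), and, where $\tau_i^*<\infty$, let $Y_i^*=Z(\tau_i^*)-Z(\tau_{i-1}^*)$ be the severity of the $i$-th record. Then for every integer $u\ge 0$ (Pollaczeck–Khinchine formula, discrete version) $$\psi(u)=(1-\mu)\sum_{k=1}^{\infty}P(S_k^*\ge u)\,\mu^k ,$$ where $S_k^*$ may be read in either of the following two ways: (a) $S_k^*=\sum_{i=1}^k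 Y_i^*$ is the sum of the first $k$ record severities, and $P(S_k^*\ge u)$ stands for the conditional probability $P(S_k^*\ge u\mid \tau_k^*<\infty)$ (if $\mu=0$, all terms of the series are read as $0$); (b) when $\mu\neq0$, $S_k^*=\sum_{i=1}^k \tilde Y_i$, where $\tilde Y_1,\tilde Y_2,\ldots$ are any i.i.d. random variables, on any probability space, with the equilibrium distribution $P(\tilde Y_i=x)=\overline F(x)/\mu$, $x=0,1,2,\ldots$. -/

import Mathlib

open MeasureTheory ProbabilityTheory

namespace GerberDickson

noncomputable section

/-- The risk process `U(t) = u + t - (Y₁ + ⋯ + Y_t)` with initial capital `u`.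
The `i`-th claim `Y_i` (`i ≥ 1`) is `Y (i - 1)`. -/
def riskProcess {Ω : Type*} (Y : ℕ → Ω → ℕ) (u t : ℕ) (ω : Ω) : ℤ :=
  (u : ℤ) + (t : ℤ) - ∑ i ∈ Finset.range t, (Y i ω : ℤ)

/-- The ruin time `τ = min {t ≥ 1 : U(t) ≤ 0}`, equal to `∞` if there is no such `t`. -/
def ruinTime {Ω : Type*} (Y : ℕ → Ω → ℕ) (u : ℕ) (ω : Ω) : ℕ∞ :=
  ⨅ (t : ℕ) (_ : 1 ≤ t ∧ riskProcess Y u t ω ≤ 0), (t : ℕ∞)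

/-- The ultimate ruin probability `ψ(u) = P(τ < ∞ | U(0) = u)`. -/
def ruinProb {Ω : Type*} [MeasurableSpace Ω] (P : Measure Ω) (Y : ℕ → Ω → ℕ) (u : ℕ) : ℝ :=
  P.real {ω | ruinTime Y u ω < ⊤}

/-- The mean claim `μ`. -/
def meanClaim {Ω : Type*} [MeasurableSpace Ω] (P : Measure Ω) (Y : ℕ → Ω → ℕ) : ℝ :=
  ∫ ω, (Y 0 ω : ℝ) ∂P

/-- The tail `P(Y₁ > x)` of the claim distribution. -/
def claimTail {Ω : Type*} [MeasurableSpace Ω] (P : Measure Ω) (Y : ℕ → Ω → ℕ) (x : ℕ) : ℝ :=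
  P.real {ω | x < Y 0 ω}

/-- The equilibrium probability function `x ↦ P(Y₁ > x) / μ` of the claims. -/
def equilibriumProb {Ω : Type*} [MeasurableSpace Ω] (P : Measure Ω) (Y : ℕ → Ω → ℕ)
    (x : ℕ) : ℝ :=
  claimTail P Y x / meanClaim P Y

/-- The surplus process `Z(t) = (Y₁ - 1) + ⋯ + (Y_t - 1)`, which is `u - U(t)`. -/
def surplus {Ω : Type*} (Y : ℕ → Ω → ℕ) (t : ℕ) (ω : Ω) : ℤ :=
  ∑ i ∈ Finset.range t, ((Y i ω : ℤ) - 1)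

/-- The record times of the surplus process: `τ*₀ = 0`, and `τ*_{i+1}` is the least `t > τ*_i`
with `Z(t) ≥ Z(τ*_i)`, equal to `∞` if there is no such `t` (in particular if `τ*_i = ∞`). -/
def recordTime {Ω : Type*} (Y : ℕ → Ω → ℕ) : ℕ → Ω → ℕ∞
  | 0, _ => 0
  | i + 1, ω =>
      ⨅ (t : ℕ) (_ : recordTime Y i ω < (t : ℕ∞) ∧
        surplus Y (recordTime Y i ω).toNat ω ≤ surplus Y t ω), (t : ℕ∞)

/-- `recordSeverity Y i` is the severity `Z(τ*_{i+1}) - Z(τ*_i)` of the `(i+1)`-st record;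
it is meaningful where `τ*_{i+1} < ∞`. -/
def recordSeverity {Ω : Type*} (Y : ℕ → Ω → ℕ) (i : ℕ) (ω : Ω) : ℤ :=
  surplus Y (recordTime Y (i + 1) ω).toNat ω - surplus Y (recordTime Y i ω).toNat ω

end

end GerberDickson

/-!
The ruin probability is computed from the records of the surplus walk `Z`.

*The first record.* Fix `x ≥ 0` and `m ≥ 1`. Reading the first `m` claims backwards preserves their
law and turns the event that `Z` makes its first record at time `m` and at height `x` into the event
that `Z` visits `x` at time `m` while staying strictly above `x` at the earlier positive times. Since
`Z` drifts to `-∞` by the law of large numbers and its steps are at least `-1`, the latter events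
exhaust, over all `m` and up to a null event, the event `Z 1 ≥ x`, which is `Y₁ > x`
(`lt_iff_exists_walk_eq`). Hence the first record has the defective law `x ↦ P(Y₁ > x)`
(`measure_firstRecord`), of total mass `μ`.

*Renewal.* The claims after a record time are independent of the earlier ones and distributed as the
whole sequence (`measure_recordIn_inter_shift`). Thus `P(τ*_k < ∞) = μ ^ k`, and the law of `Z(τ*_k)`
on `{τ*_k < ∞}` is the `k`-fold convolution of `x ↦ P(Y₁ > x)`, which is `μ ^ k` times the law of a
sum of `k` independent equilibrium variables (`measure_recordIn_Ici_eq_mul`).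

*Ruin.* Ruin occurs exactly when `Z` reaches `u` at some record, and then `Z ≥ u` at the last record,
which exists almost surely. That a given record is the last one has probability `1 - μ`,
independently of its height; summing over its index gives the formula (`hasSum_ruinProb`).
-/

namespace GerberDickson

/-! ### Paths of the surplus process -/

/-- The walk with steps `y i - 1` along a fixed claim sequence `y`, started at `0`. -/
def walk (y : ℕ → ℕ) (t : ℕ) : ℤ := ∑ i ∈ Finset.range t, ((y i : ℤ) - 1)

/-- The claim sequences whose walk makes its first (weak) record at height `x`. -/
def firstRecord (x : ℕ) : Set (ℕ → ℕ) :=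
  {y | ∃ m, 1 ≤ m ∧ walk y m = x ∧ ∀ j, 1 ≤ j → j < m → walk y j < 0}

@[simp] lemma walk_zero (y : ℕ → ℕ) : walk y 0 = 0 := by simp [walk]

lemma walk_succ (y : ℕ → ℕ) (t : ℕ) : walk y (t + 1) = walk y t + ((y t : ℤ) - 1) := by
  rw [walk, walk, Finset.sum_range_succ]

lemma walk_add (y : ℕ → ℕ) (t m : ℕ) :
    walk y (t + m) = walk y t + walk (fun i => y (t + i)) m := by
  simp only [walk, Finset.sum_range_add]

/-- The encoding of `min {t | p t}` as an infimum in `ℕ∞` takes the value `n` exactly when `n` is the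
least element. -/
lemma iInf_coe_eq_coe_iff (p : ℕ → Prop) (n : ℕ) :
    (⨅ (t : ℕ) (_ : p t), (t : ℕ∞)) = n ↔ p n ∧ ∀ j, p j → n ≤ j := by
  classical
  have hle {j : ℕ} (hj : p j) : (⨅ (t : ℕ) (_ : p t), (t : ℕ∞)) ≤ j := iInf₂_le j hj
  constructor
  · intro h
    have hmin : ∀ j, p j → n ≤ j := fun j hj => by
      have := hle hj
      rw [h] at this
      exact_mod_cast this
    have hex : ∃ t, p t := by
      by_contra! hne
      simp [hne] at h
    refine ⟨?_, hmin⟩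
    have : ((Nat.find hex : ℕ) : ℕ∞) ≤ n := by
      rw [← h]
      exact le_iInf₂ fun j hj => by exact_mod_cast Nat.find_min' hex hj
    have h1 : Nat.find hex ≤ n := by exact_mod_cast this
    have h2 := hmin _ (Nat.find_spec hex)
    rw [le_antisymm h2 h1]
    exact Nat.find_spec hex
  · rintro ⟨h1, h2⟩
    exact le_antisymm (hle h1) (le_iInf₂ fun j hj => by exact_mod_cast h2 j hj)

section Paths

variable {Ω : Type*} (Y : ℕ → Ω → ℕ)

lemma surplus_eq_walk (t : ℕ) (ω : Ω) : surplus Y t ω = walk (fun i => Y i ω) t := rfl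

@[simp] lemma surplus_zero (ω : Ω) : surplus Y 0 ω = 0 := by simp [surplus]

lemma recordTime_lt_top_iff (k : ℕ) (ω : Ω) :
    recordTime Y k ω < ⊤ ↔ ∃ t : ℕ, recordTime Y k ω = t := by
  rw [lt_top_iff_ne_top, ENat.ne_top_iff_exists]
  simp only [eq_comm]

lemma recordTime_succ_eq_coe_iff (k t : ℕ) (ω : Ω) :
    recordTime Y (k + 1) ω = t ↔ ∃ r : ℕ, recordTime Y k ω = r ∧ r < t ∧
      surplus Y r ω ≤ surplus Y t ω ∧ ∀ j, r < j → j < t → surplus Y j ω < surplus Y r ω := by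
  rw [recordTime, iInf_coe_eq_coe_iff]
  constructor
  · rintro ⟨⟨h1, h2⟩, h3⟩
    obtain ⟨r, hr⟩ := (recordTime_lt_top_iff Y k ω).1 (h1.trans_le le_top)
    simp only [hr, ENat.toNat_natCast, Nat.cast_lt] at h1 h2 h3
    refine ⟨r, hr, h1, h2, fun j hj hjt => ?_⟩
    by_contra! hc
    exact absurd (h3 j ⟨hj, hc⟩) (by omega)
  · rintro ⟨r, hr, h1, h2, h3⟩
    simp only [hr, ENat.toNat_natCast, Nat.cast_lt]
    refine ⟨⟨h1, h2⟩, fun j ⟨hj, hc⟩ => ?_⟩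
    by_contra! hjt
    exact absurd (h3 j hj hjt) (by omega)

/-- A record after `τ*_k` is a first record of the walk restarted at time `τ*_k`. -/
lemma mem_firstRecord_iff {k t : ℕ} {ω : Ω} (ht : recordTime Y k ω = t) (x : ℕ) :
    (fun i => Y (t + i) ω) ∈ firstRecord x ↔
      ∃ r : ℕ, recordTime Y (k + 1) ω = r ∧ surplus Y r ω = surplus Y t ω + x := by
  have hw (m : ℕ) : walk (fun i => Y (t + i) ω) m = surplus Y (t + m) ω - surplus Y t ω := by
    rw [surplus_eq_walk, surplus_eq_walk, walk_add]
    ring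
  simp only [firstRecord, Set.mem_ofPred_eq, hw, recordTime_succ_eq_coe_iff]
  constructor
  · rintro ⟨m, hm, h1, h2⟩
    refine ⟨t + m, ⟨t, ht, by omega, by omega, fun j hj hjm => ?_⟩, by omega⟩
    have := h2 (j - t) (by omega) (by omega)
    rw [Nat.add_sub_cancel' hj.le] at this
    omega
  · rintro ⟨r, ⟨t', ht', h1, h2, h3⟩, h4⟩
    obtain rfl : t = t' := by exact_mod_cast ht.symm.trans ht'
    refine ⟨r - t, by omega, ?_, fun j hj hjm => ?_⟩
    · rw [Nat.add_sub_cancel' h1.le]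
      omega
    · have := h3 (t + j) (by omega) (by omega)
      omega

lemma surplus_recordTime_succ {k : ℕ} {ω : Ω} (h : recordTime Y (k + 1) ω < ⊤) :
    recordTime Y k ω < ⊤ ∧
      surplus Y (recordTime Y k ω).toNat ω ≤ surplus Y (recordTime Y (k + 1) ω).toNat ω := by
  obtain ⟨t, ht⟩ := (recordTime_lt_top_iff Y _ ω).1 h
  obtain ⟨r, hr, -, h2, -⟩ := (recordTime_succ_eq_coe_iff Y k t ω).1 ht
  rw [ht, hr]
  exact ⟨ENat.natCast_lt_top r, h2⟩

lemma surplus_recordTime_mono {k l : ℕ} (hkl : k ≤ l) {ω : Ω} (h : recordTime Y l ω < ⊤) :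
    recordTime Y k ω < ⊤ ∧
      surplus Y (recordTime Y k ω).toNat ω ≤ surplus Y (recordTime Y l ω).toNat ω := by
  induction l, hkl using Nat.le_induction with
  | base => exact ⟨h, le_rfl⟩
  | succ l _ ih =>
    have h1 := surplus_recordTime_succ Y h
    have h2 := ih h1.1
    exact ⟨h2.1, h2.2.trans h1.2⟩

lemma surplus_recordTime_nonneg {k : ℕ} {ω : Ω} (h : recordTime Y k ω < ⊤) :
    0 ≤ surplus Y (recordTime Y k ω).toNat ω := by
  simpa [recordTime] using (surplus_recordTime_mono Y (Nat.zero_le k) h).2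

lemma le_recordTime {k r : ℕ} {ω : Ω} (h : recordTime Y k ω = r) : k ≤ r := by
  induction k generalizing r with
  | zero => exact Nat.zero_le r
  | succ k ih =>
    obtain ⟨t, ht, h1, -, -⟩ := (recordTime_succ_eq_coe_iff Y k r ω).1 h
    have := ih ht
    omega

/-- The last record time up to time `t`: afterwards the surplus stays strictly below it. -/
lemma exists_last_recordTime (t : ℕ) (ω : Ω) :
    ∃ k r : ℕ, recordTime Y k ω = r ∧ r ≤ t ∧
      ∀ j, r < j → j ≤ t → surplus Y j ω < surplus Y r ω := by
  induction t with
  | zero => exact ⟨0, 0, rfl, le_rfl, fun j h1 h2 => by omega⟩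
  | succ t ih =>
    obtain ⟨k, r, hk, hr, h⟩ := ih
    by_cases hlt : surplus Y (t + 1) ω < surplus Y r ω
    · refine ⟨k, r, hk, by omega, fun j h1 h2 => ?_⟩
      obtain h3 | rfl := Nat.le_succ_iff.1 h2
      · exact h j h1 h3
      · exact hlt
    · refine ⟨k + 1, t + 1, ?_, le_rfl, fun j h1 h2 => by omega⟩
      exact (recordTime_succ_eq_coe_iff Y k (t + 1) ω).2
        ⟨r, hk, by omega, not_lt.1 hlt, fun j h1 h2 => h j h1 (by omega)⟩

lemma ruinTime_lt_top_iff (u : ℕ) (ω : Ω) :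
    ruinTime Y u ω < ⊤ ↔ ∃ t : ℕ, 1 ≤ t ∧ (u : ℤ) ≤ surplus Y t ω := by
  have h (t : ℕ) : riskProcess Y u t ω = u - surplus Y t ω := by
    simp only [riskProcess, surplus, Finset.sum_sub_distrib, Finset.sum_const, Finset.card_range,
      nsmul_eq_mul, mul_one]
    ring
  simp [ruinTime, iInf_lt_iff, h]

/-- Ruin occurs exactly when the surplus reaches the initial capital at some record. -/
lemma ruinTime_lt_top_iff_record (u : ℕ) (ω : Ω) :
    ruinTime Y u ω < ⊤ ↔ ∃ k, recordTime Y (k + 1) ω < ⊤ ∧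
      (u : ℤ) ≤ surplus Y (recordTime Y (k + 1) ω).toNat ω := by
  rw [ruinTime_lt_top_iff]
  constructor
  · rintro ⟨t, ht, hu⟩
    obtain ⟨k, r, hk, hr, h⟩ := exists_last_recordTime Y t ω
    have hle : surplus Y t ω ≤ surplus Y r ω := by
      obtain rfl | hlt := hr.eq_or_lt
      · exact le_rfl
      · exact (h t hlt le_rfl).le
    cases k with
    | zero =>
      have h0 : (0 : ℕ∞) = r := hk
      obtain rfl : 0 = r := by exact_mod_cast h0
      have := h t (by omega) le_rfl
      rw [surplus_zero] at this
      omega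
    | succ k => exact ⟨k, by simp [hk], by simpa [hk] using hu.trans hle⟩
  · rintro ⟨k, h, hu⟩
    obtain ⟨r, hr⟩ := (recordTime_lt_top_iff Y _ ω).1 h
    have := le_recordTime Y hr
    exact ⟨r, by omega, by simpa [hr] using hu⟩

lemma sum_recordSeverity (k : ℕ) (ω : Ω) :
    ∑ i ∈ Finset.range k, recordSeverity Y i ω = surplus Y (recordTime Y k ω).toNat ω := by
  simp only [recordSeverity]
  rw [Finset.sum_range_sub (fun i => surplus Y (recordTime Y i ω).toNat ω)]
  simp [recordTime]

/-- The event that the `k`-th record is made, with the surplus in `C`. -/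
def recordIn (k : ℕ) (C : Set ℤ) : Set Ω :=
  {ω | recordTime Y k ω < ⊤ ∧ surplus Y (recordTime Y k ω).toNat ω ∈ C}

lemma recordIn_eq_iUnion (k : ℕ) (C : Set ℤ) :
    recordIn Y k C = ⋃ t : ℕ, {ω | recordTime Y k ω = t} ∩ {ω | surplus Y t ω ∈ C} := by
  ext ω
  simp only [recordIn, Set.mem_ofPred_eq, recordTime_lt_top_iff, Set.mem_iUnion,
    Set.mem_inter_iff]
  constructor
  · rintro ⟨⟨t, ht⟩, h⟩
    exact ⟨t, ht, by simpa [ht] using h⟩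
  · rintro ⟨t, ht, h⟩
    exact ⟨⟨t, ht⟩, by simpa [ht] using h⟩

lemma disjoint_recordTime_eq (k : ℕ) {s t : ℕ} (h : s ≠ t) :
    Disjoint {ω | recordTime Y k ω = s} {ω | recordTime Y k ω = t} :=
  Set.disjoint_left.2 fun ω (h1 : _ = _) (h2 : _ = _) => h (by exact_mod_cast h1.symm.trans h2)

lemma recordIn_inter_shift_eq_iUnion (k : ℕ) (C : Set ℤ) (B : Set (ℕ → ℕ)) :
    recordIn Y k C ∩ {ω | (fun i => Y ((recordTime Y k ω).toNat + i) ω) ∈ B} =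
      ⋃ t : ℕ, ({ω | recordTime Y k ω = t} ∩ {ω | surplus Y t ω ∈ C}) ∩
        {ω | (fun i => Y (t + i) ω) ∈ B} := by
  rw [recordIn_eq_iUnion, Set.iUnion_inter]
  refine Set.iUnion_congr fun t => ?_
  ext ω
  refine and_congr_right fun h => ?_
  simp [show recordTime Y k ω = t from h.1]

end Paths

/-! ### Measurability -/

lemma measurable_walk (t : ℕ) : Measurable fun y : ℕ → ℕ => walk y t := by
  unfold walk
  fun_prop

lemma measurableSet_firstRecord (x : ℕ) : MeasurableSet (firstRecord x) := by
  have : firstRecord x = ⋃ m, {y | 1 ≤ m ∧ walk y m = x ∧ ∀ j, 1 ≤ j → j < m → walk y j < 0} := by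
    ext y
    simp [firstRecord]
  rw [this]
  have hw := measurable_walk
  measurability

lemma measurable_surplus {Ω : Type*} [MeasurableSpace Ω] {Y : ℕ → Ω → ℕ} {t : ℕ}
    (hY : ∀ i < t, Measurable (Y i)) : Measurable (surplus Y t) := by
  refine Finset.measurable_fun_sum _ fun i hi => ?_
  exact (measurable_from_top (f := fun n : ℕ => (n : ℤ) - 1)).comp (hY i (Finset.mem_range.1 hi))

/-- Record times are stopping times: whether `τ*_k = t` is determined by the first `t` claims. -/
lemma measurableSet_recordTime_eq {Ω : Type*} [MeasurableSpace Ω] {Y : ℕ → Ω → ℕ} (k : ℕ) {t : ℕ}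
    (hY : ∀ i < t, Measurable (Y i)) : MeasurableSet {ω | recordTime Y k ω = t} := by
  induction k generalizing t with
  | zero => simp [recordTime]
  | succ k ih =>
    have hZ {j : ℕ} (hj : j ≤ t) : Measurable (surplus Y j) :=
      measurable_surplus fun i hi => hY i (by omega)
    have : {ω | recordTime Y (k + 1) ω = t} = ⋃ r, ⋃ (_ : r < t), {ω | recordTime Y k ω = r} ∩
        ({ω | surplus Y r ω ≤ surplus Y t ω} ∩
          ⋂ j, ⋂ (_ : r < j), ⋂ (_ : j < t), {ω | surplus Y j ω < surplus Y r ω}) := by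
      ext ω
      simp only [Set.mem_ofPred_eq, recordTime_succ_eq_coe_iff, Set.mem_iUnion, Set.mem_inter_iff,
        Set.mem_iInter]
      grind
    rw [this]
    refine .iUnion fun r => .iUnion fun hr => ?_
    refine (ih fun i hi => hY i (by omega)).inter
      ((measurableSet_le (hZ hr.le) (hZ le_rfl)).inter ?_)
    exact .iInter fun j => .iInter fun _ => .iInter fun hj => measurableSet_lt (hZ hj.le) (hZ hr.le)

lemma measurableSet_recordTime_inter {Ω : Type*} [MeasurableSpace Ω] {Y : ℕ → Ω → ℕ} (k : ℕ)
    (C : Set ℤ) {t : ℕ} (hY : ∀ i < t, Measurable (Y i)) :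
    MeasurableSet ({ω | recordTime Y k ω = t} ∩ {ω | surplus Y t ω ∈ C}) :=
  (measurableSet_recordTime_eq k hY).inter (measurable_surplus hY (MeasurableSet.of_discrete))

/-! ### The law of the claims -/

section Law

variable {Ω : Type*} [MeasurableSpace Ω] {P : Measure Ω} {Y : ℕ → Ω → ℕ}

/-- An i.i.d. sequence keeps its law when its terms are selected and reordered injectively. -/
lemma map_comp_injective (hY : ∀ i, Measurable (Y i)) (hindep : iIndepFun Y P)
    (hident : ∀ i, IdentDistrib (Y i) (Y 0) P P) {σ : ℕ → ℕ} (hσ : σ.Injective) :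
    P.map (fun ω i => Y (σ i) ω) = P.map (fun ω i => Y i ω) := by
  rw [(hindep.precomp hσ).map_fun_eq_infinitePi_map fun i => hY (σ i),
    hindep.map_fun_eq_infinitePi_map hY]
  simp only [fun i => (hident i).map_eq]

lemma measure_comp_injective (hY : ∀ i, Measurable (Y i)) (hindep : iIndepFun Y P)
    (hident : ∀ i, IdentDistrib (Y i) (Y 0) P P) {σ : ℕ → ℕ} (hσ : σ.Injective)
    {B : Set (ℕ → ℕ)} (hB : MeasurableSet B) :
    P {ω | (fun i => Y (σ i) ω) ∈ B} = P {ω | (fun i => Y i ω) ∈ B} := by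
  have := congrArg (fun ν => ν B) (map_comp_injective hY hindep hident hσ)
  rwa [Measure.map_apply (by fun_prop) hB, Measure.map_apply (by fun_prop) hB] at this

/-- An event about the claims before time `t` is independent of the claims from time `t` on, which
are distributed as the whole claim sequence. That `A` is such an event is expressed by its
measurability for every σ-algebra that makes these claims measurable. -/
lemma measure_inter_shift (hY : ∀ i, Measurable (Y i)) (hindep : iIndepFun Y P)
    (hident : ∀ i, IdentDistrib (Y i) (Y 0) P P) (t : ℕ) {A : Set Ω}
    (hA : ∀ m : MeasurableSpace Ω, (∀ i < t, Measurable[m] (Y i)) → MeasurableSet[m] A)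
    {B : Set (ℕ → ℕ)} (hB : MeasurableSet B) :
    P (A ∩ {ω | (fun i => Y (t + i) ω) ∈ B}) = P A * P {ω | (fun i => Y i ω) ∈ B} := by
  have hind := indep_iSup_of_disjoint (fun i => (hY i).comap_le) hindep
    (S := Set.Iio t) (T := Set.Ici t)
    (Set.disjoint_left.2 fun i h1 h2 => not_lt.2 (Set.mem_Ici.1 h2) h1)
  rw [(Indep_iff _ _ _).1 hind A _ (hA _ fun i hi => ?_) ?_]
  · rw [measure_comp_injective hY hindep hident (add_right_injective t) hB]
  · refine @measurable_pi_lambda _ _ _ (_) _ _ (fun i => ?_) _ hB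
    exact Measurable.of_comap_le (le_iSup₂_of_le (t + i) (Nat.le_add_right t i) le_rfl)
  · exact Measurable.of_comap_le (le_iSup₂_of_le i hi le_rfl)

/-! ### The first record -/

/-- By the law of large numbers the surplus is eventually negative. -/
lemma ae_eventually_surplus_neg (hindep : iIndepFun Y P)
    (hident : ∀ i, IdentDistrib (Y i) (Y 0) P P)
    (hint : Integrable (fun ω => (Y 0 ω : ℝ)) P) (hprofit : meanClaim P Y < 1) :
    ∀ᵐ ω ∂P, ∀ᶠ t in Filter.atTop, surplus Y t ω < 0 := by
  have hcast : Measurable fun n : ℕ => (n : ℝ) := measurable_from_top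
  have := strong_law_ae_real (fun i ω => (Y i ω : ℝ)) hint
    (fun i j hij => (hindep.indepFun hij).comp hcast hcast) fun i => (hident i).comp hcast
  filter_upwards [this] with ω hω
  filter_upwards [hω.eventually_lt_const hprofit, Filter.eventually_gt_atTop 0] with t ht h0
  rw [div_lt_one (by exact_mod_cast h0)] at ht
  have : ∑ i ∈ Finset.range t, (Y i ω : ℤ) < t := by exact_mod_cast ht
  simpa [surplus] using this

/-- The reindexing that reads the first `m` claims backwards and keeps the others in place. -/
def reversal (m i : ℕ) : ℕ := if i < m then m - 1 - i else i

lemma reversal_injective (m : ℕ) : (reversal m).Injective := by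
  intro i j h
  unfold reversal at h
  grind

lemma walk_reversal (y : ℕ → ℕ) {m j : ℕ} (hj : j ≤ m) :
    walk (fun i => y (reversal m i)) j = walk y m - walk y (m - j) := by
  induction j with
  | zero => simp
  | succ j ih =>
    have h1 : m - j = m - (j + 1) + 1 := by omega
    have h2 : reversal m j = m - (j + 1) := by
      simp only [reversal, if_pos (show j < m by omega)]
      omega
    rw [walk_succ, ih (by omega), h1, walk_succ, h2]
    ring

/-- Along a walk that becomes negative, the first claim exceeds `x` exactly when the walk visits
`x` after staying strictly above `x` at all earlier positive times: its steps are at least `-1`, so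
it cannot jump below `x` without visiting it. -/
lemma lt_iff_exists_walk_eq {y : ℕ → ℕ} (hy : ∀ᶠ t in Filter.atTop, walk y t < 0) (x : ℕ) :
    x < y 0 ↔ ∃ m, 1 ≤ m ∧ walk y m = x ∧ ∀ j, 1 ≤ j → j < m → (x : ℤ) < walk y j := by
  classical
  have h1 : walk y 1 = y 0 - 1 := by simp [walk]
  constructor
  · intro hx
    have hex : ∃ t, 1 ≤ t ∧ walk y t ≤ x := by
      obtain ⟨t, ht, ht'⟩ := (hy.and (Filter.eventually_ge_atTop 1)).exists
      exact ⟨t, ht', by omega⟩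
    obtain ⟨hm, hmx⟩ := Nat.find_spec hex
    have hmin : ∀ j, 1 ≤ j → j < Nat.find hex → (x : ℤ) < walk y j := fun j hj hjm => by
      have := Nat.find_min hex hjm
      grind
    refine ⟨Nat.find hex, hm, le_antisymm hmx ?_, hmin⟩
    obtain h | h := hm.eq_or_lt
    · rw [← h, h1]
      omega
    · have h2 := hmin (Nat.find hex - 1) (by omega) (by omega)
      have h3 := walk_succ y (Nat.find hex - 1)
      rw [Nat.sub_add_cancel hm] at h3
      omega
  · rintro ⟨m, hm, hmx, h⟩
    obtain rfl | hm1 := hm.eq_or_lt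
    · omega
    · have := h 1 le_rfl hm1
      omega

/-- The defective law of the first record: by time reversal, making the first record at height `x`
is as likely as visiting `x` from above, hence as likely as a first claim larger than `x`. -/
lemma measure_firstRecord (hY : ∀ i, Measurable (Y i)) (hindep : iIndepFun Y P)
    (hident : ∀ i, IdentDistrib (Y i) (Y 0) P P)
    (hint : Integrable (fun ω => (Y 0 ω : ℝ)) P) (hprofit : meanClaim P Y < 1) (x : ℕ) :
    P {ω | (fun i => Y i ω) ∈ firstRecord x} = P {ω | x < Y 0 ω} := by
  -- `F m`: the first record occurs at time `m`; `V m`: the reversed event, `x` is visited from above.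
  let F (m : ℕ) : Set (ℕ → ℕ) := {y | 1 ≤ m ∧ walk y m = x ∧ ∀ j, 1 ≤ j → j < m → walk y j < 0}
  let V (m : ℕ) : Set (ℕ → ℕ) :=
    {y | 1 ≤ m ∧ walk y m = x ∧ ∀ j, 1 ≤ j → j < m → (x : ℤ) < walk y j}
  have hw := measurable_walk
  have hF (m : ℕ) : MeasurableSet (F m) := by measurability
  have hV (m : ℕ) : MeasurableSet (V m) := by measurability
  have hYseq : Measurable fun ω i => Y i ω := by fun_prop
  have hFV (m : ℕ) : P {ω | (fun i => Y i ω) ∈ F m} = P {ω | (fun i => Y i ω) ∈ V m} := by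
    rw [← measure_comp_injective hY hindep hident (reversal_injective m) (hF m)]
    congr 1
    ext ω
    have hrev {j : ℕ} (hj : j ≤ m) := walk_reversal (fun i => Y i ω) hj
    simp only [F, V, Set.mem_ofPred_eq, hrev le_rfl, Nat.sub_self, walk_zero, sub_zero]
    refine and_congr_right fun hm => and_congr_right fun hx => ⟨fun h j hj hjm => ?_,
      fun h j hj hjm => ?_⟩
    · have h1 := h (m - j) (by omega) (by omega)
      rw [hrev (by omega), Nat.sub_sub_self hjm.le] at h1
      omega
    · have h1 := h (m - j) (by omega) (by omega)
      rw [hrev hjm.le]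
      omega
  have hFdisj : Pairwise (Function.onFun Disjoint fun m => {ω | (fun i => Y i ω) ∈ F m}) := by
    intro m n hmn
    refine Set.disjoint_left.2 fun ω ⟨hm, h1, h2⟩ ⟨hn, h3, h4⟩ => ?_
    obtain h | h := hmn.lt_or_gt
    · have := h4 m hm h
      omega
    · have := h2 n hn h
      omega
  have hVdisj : Pairwise (Function.onFun Disjoint fun m => {ω | (fun i => Y i ω) ∈ V m}) := by
    intro m n hmn
    refine Set.disjoint_left.2 fun ω ⟨hm, h1, h2⟩ ⟨hn, h3, h4⟩ => ?_
    obtain h | h := hmn.lt_or_gt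
    · have := h4 m hm h
      omega
    · have := h2 n hn h
      omega
  calc P {ω | (fun i => Y i ω) ∈ firstRecord x}
      = P (⋃ m, {ω | (fun i => Y i ω) ∈ F m}) := by
        congr 1
        ext ω
        simp [firstRecord, F]
    _ = P (⋃ m, {ω | (fun i => Y i ω) ∈ V m}) := by
        rw [measure_iUnion hFdisj fun m => hYseq (hF m),
          measure_iUnion hVdisj fun m => hYseq (hV m)]
        exact tsum_congr hFV
    _ = P {ω | x < Y 0 ω} := by
        refine measure_congr ?_
        filter_upwards [ae_eventually_surplus_neg hindep hident hint hprofit] with ω hω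
        refine propext (Iff.trans ?_ (lt_iff_exists_walk_eq (y := fun i => Y i ω) hω x).symm)
        exact Set.mem_iUnion

/-- The mean claim is the sum of the tail probabilities. -/
lemma ofReal_meanClaim (hY : ∀ i, Measurable (Y i))
    (hint : Integrable (fun ω => (Y 0 ω : ℝ)) P) :
    ENNReal.ofReal (meanClaim P Y) = ∑' x, P {ω | x < Y 0 ω} := by
  have hset (x : ℕ) : MeasurableSet {ω | x < Y 0 ω} := measurableSet_lt measurable_const (hY 0)
  rw [meanClaim, ofReal_integral_eq_lintegral_ofReal hint (.of_forall fun ω => Nat.cast_nonneg _)]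
  simp_rw [← fun x => lintegral_indicator_one (μ := P) (hset x)]
  rw [← lintegral_tsum fun x => (measurable_one.indicator (hset x)).aemeasurable]
  refine lintegral_congr fun ω => ?_
  rw [ENNReal.ofReal_natCast, tsum_eq_sum (s := Finset.range (Y 0 ω))]
  · rw [Finset.sum_congr rfl (g := fun _ => 1) fun x hx => ?_]
    · simp
    · simpa [Set.indicator] using hx
  · intro x hx
    simpa [Set.indicator] using hx

/-- The walk makes a record with probability `μ`. -/
lemma measure_exists_firstRecord (hY : ∀ i, Measurable (Y i)) (hindep : iIndepFun Y P)
    (hident : ∀ i, IdentDistrib (Y i) (Y 0) P P)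
    (hint : Integrable (fun ω => (Y 0 ω : ℝ)) P) (hprofit : meanClaim P Y < 1) :
    P {ω | (fun i => Y i ω) ∈ ⋃ x, firstRecord x} = ENNReal.ofReal (meanClaim P Y) := by
  have hYseq : Measurable fun ω i => Y i ω := by fun_prop
  have : {ω | (fun i => Y i ω) ∈ ⋃ x, firstRecord x} =
      ⋃ x, {ω | (fun i => Y i ω) ∈ firstRecord x} := by
    ext ω
    simp
  rw [this, ofReal_meanClaim hY hint, measure_iUnion ?_ fun x => ?_]
  · exact tsum_congr (measure_firstRecord hY hindep hident hint hprofit)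
  · intro x y hxy
    refine Set.disjoint_left.2 fun ω ⟨m, hm, h1, h2⟩ ⟨n, hn, h3, h4⟩ => ?_
    obtain h | rfl | h := lt_trichotomy m n
    · have := h4 m hm h
      omega
    · omega
    · have := h2 n hn h
      omega
  · exact hYseq (measurableSet_firstRecord x)

/-! ### Later records -/

lemma measurableSet_recordIn (hY : ∀ i, Measurable (Y i)) (k : ℕ) (C : Set ℤ) :
    MeasurableSet (recordIn Y k C) := by
  rw [recordIn_eq_iUnion]
  exact .iUnion fun t => measurableSet_recordTime_inter k C fun i _ => hY i

lemma measurableSet_shift (hY : ∀ i, Measurable (Y i)) (t : ℕ) {B : Set (ℕ → ℕ)}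
    (hB : MeasurableSet B) : MeasurableSet {ω | (fun i => Y (t + i) ω) ∈ B} := by
  have : Measurable fun ω i => Y (t + i) ω := by fun_prop
  exact this hB

lemma measurableSet_recordIn_inter_shift (hY : ∀ i, Measurable (Y i)) (k : ℕ) (C : Set ℤ)
    {B : Set (ℕ → ℕ)} (hB : MeasurableSet B) : MeasurableSet
      (recordIn Y k C ∩ {ω | (fun i => Y ((recordTime Y k ω).toNat + i) ω) ∈ B}) := by
  rw [recordIn_inter_shift_eq_iUnion]
  exact .iUnion fun t => (measurableSet_recordTime_inter k C fun i _ => hY i).inter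
    (measurableSet_shift hY t hB)

/-- The strong Markov property at the `k`-th record time. -/
lemma measure_recordIn_inter_shift (hY : ∀ i, Measurable (Y i)) (hindep : iIndepFun Y P)
    (hident : ∀ i, IdentDistrib (Y i) (Y 0) P P) (k : ℕ) (C : Set ℤ)
    {B : Set (ℕ → ℕ)} (hB : MeasurableSet B) :
    P (recordIn Y k C ∩ {ω | (fun i => Y ((recordTime Y k ω).toNat + i) ω) ∈ B}) =
      P (recordIn Y k C) * P {ω | (fun i => Y i ω) ∈ B} := by
  have hA (t : ℕ) := measurableSet_recordTime_inter k C (t := t) fun i _ => hY i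
  have hdisj : Pairwise (Function.onFun Disjoint fun t : ℕ =>
      {ω | recordTime Y k ω = t} ∩ {ω | surplus Y t ω ∈ C}) := fun s t hst =>
    (disjoint_recordTime_eq Y k hst).mono Set.inter_subset_left Set.inter_subset_left
  rw [recordIn_inter_shift_eq_iUnion, measure_iUnion (fun s t hst => (hdisj hst).mono
      Set.inter_subset_left Set.inter_subset_left)
      fun t => (hA t).inter (measurableSet_shift hY t hB),
    recordIn_eq_iUnion, measure_iUnion hdisj hA, ← ENNReal.tsum_mul_right]
  exact tsum_congr fun t => measure_inter_shift hY hindep hident t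
    (fun m hm => measurableSet_recordTime_inter k C hm) hB

lemma measure_recordIn_zero_singleton [IsProbabilityMeasure P] (s : ℕ) :
    P (recordIn Y 0 {(s : ℤ)}) = if s = 0 then 1 else 0 := by
  by_cases h : s = 0
  · simp [recordIn, recordTime, h]
  · simp [recordIn, recordTime, h, eq_comm]

/-- The renewal equation for the heights of the records. -/
lemma measure_recordIn_succ (hY : ∀ i, Measurable (Y i)) (hindep : iIndepFun Y P)
    (hident : ∀ i, IdentDistrib (Y i) (Y 0) P P)
    (hint : Integrable (fun ω => (Y 0 ω : ℝ)) P) (hprofit : meanClaim P Y < 1) (k s : ℕ) :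
    P (recordIn Y (k + 1) {(s : ℤ)}) =
      ∑ j ∈ Finset.range (s + 1), P (recordIn Y k {(j : ℤ)}) * P {ω | s - j < Y 0 ω} := by
  have hunion : recordIn Y (k + 1) {(s : ℤ)} = ⋃ j ∈ Finset.range (s + 1),
      recordIn Y k {(j : ℤ)} ∩
        {ω | (fun i => Y ((recordTime Y k ω).toNat + i) ω) ∈ firstRecord (s - j)} := by
    ext ω
    simp only [Set.mem_iUnion, Set.mem_inter_iff, exists_prop, Finset.mem_range]
    constructor
    · rintro ⟨h, hs⟩
      obtain ⟨h1, h2⟩ := surplus_recordTime_succ Y h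
      have h3 := surplus_recordTime_nonneg Y h1
      obtain ⟨r, hr⟩ := (recordTime_lt_top_iff Y _ ω).1 h
      obtain ⟨t, ht⟩ := (recordTime_lt_top_iff Y _ ω).1 h1
      simp only [hr, ht, ENat.toNat_natCast, Set.mem_singleton_iff] at hs h2 h3
      refine ⟨(surplus Y t ω).toNat, by omega, ⟨h1, ?_⟩, ?_⟩
      · simp [ht, h3]
      · simp only [ht, ENat.toNat_natCast, Set.mem_ofPred_eq]
        exact (mem_firstRecord_iff Y ht _).2 ⟨r, hr, by omega⟩
    · rintro ⟨j, hj, ⟨h1, h2⟩, h3⟩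
      obtain ⟨t, ht⟩ := (recordTime_lt_top_iff Y _ ω).1 h1
      simp only [ht, ENat.toNat_natCast, Set.mem_singleton_iff, Set.mem_ofPred_eq] at h2 h3
      obtain ⟨r, hr, h4⟩ := (mem_firstRecord_iff Y ht _).1 h3
      refine ⟨by simp [hr], ?_⟩
      simp only [hr, ENat.toNat_natCast, Set.mem_singleton_iff]
      omega
  rw [hunion, measure_biUnion_finset]
  · refine Finset.sum_congr rfl fun j _ => ?_
    rw [measure_recordIn_inter_shift hY hindep hident k _ (measurableSet_firstRecord _),
      measure_firstRecord hY hindep hident hint hprofit]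
  · intro i _ j _ hij
    refine Set.disjoint_left.2 fun ω h1 h2 => hij ?_
    have h3 := h1.1.2
    have h4 := h2.1.2
    rw [Set.mem_singleton_iff] at h3 h4
    omega
  · exact fun j _ => measurableSet_recordIn_inter_shift hY k _ (measurableSet_firstRecord _)

/-- A further record is made with probability `μ`, independently of the height reached so far. -/
lemma measure_recordIn_inter_succ (hY : ∀ i, Measurable (Y i)) (hindep : iIndepFun Y P)
    (hident : ∀ i, IdentDistrib (Y i) (Y 0) P P)
    (hint : Integrable (fun ω => (Y 0 ω : ℝ)) P) (hprofit : meanClaim P Y < 1)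
    (k : ℕ) (C : Set ℤ) :
    P (recordIn Y k C ∩ {ω | recordTime Y (k + 1) ω < ⊤}) =
      P (recordIn Y k C) * ENNReal.ofReal (meanClaim P Y) := by
  rw [← measure_exists_firstRecord hY hindep hident hint hprofit,
    ← measure_recordIn_inter_shift hY hindep hident k C (.iUnion measurableSet_firstRecord)]
  congr 1
  ext ω
  refine and_congr_right fun ⟨h, _⟩ => ?_
  obtain ⟨t, ht⟩ := (recordTime_lt_top_iff Y _ ω).1 h
  simp only [ht, ENat.toNat_natCast, Set.mem_ofPred_eq, Set.mem_iUnion, mem_firstRecord_iff Y ht]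
  constructor
  · intro h1
    obtain ⟨r, hr⟩ := (recordTime_lt_top_iff Y _ ω).1 h1
    have := (surplus_recordTime_succ Y h1).2
    simp only [hr, ht, ENat.toNat_natCast] at this
    exact ⟨(surplus Y r ω - surplus Y t ω).toNat, r, hr, by omega⟩
  · rintro ⟨x, r, hr, -⟩
    simp [hr]

lemma measure_recordTime_lt_top (hY : ∀ i, Measurable (Y i)) (hindep : iIndepFun Y P)
    (hident : ∀ i, IdentDistrib (Y i) (Y 0) P P)
    (hint : Integrable (fun ω => (Y 0 ω : ℝ)) P) (hprofit : meanClaim P Y < 1) (k : ℕ) :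
    P {ω | recordTime Y k ω < ⊤} = ENNReal.ofReal (meanClaim P Y) ^ k := by
  have := hindep.isProbabilityMeasure
  induction k with
  | zero => simp [recordTime]
  | succ k ih =>
    have h := measure_recordIn_inter_succ hY hindep hident hint hprofit k Set.univ
    have h1 : recordIn Y k Set.univ = {ω | recordTime Y k ω < ⊤} := by simp [recordIn]
    have h2 : {ω | recordTime Y k ω < ⊤} ∩ {ω | recordTime Y (k + 1) ω < ⊤} =
        {ω | recordTime Y (k + 1) ω < ⊤} :=
      Set.inter_eq_right.2 fun ω hω => (surplus_recordTime_succ Y hω).1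
    rw [pow_succ, ← ih, ← h1, ← h, h1, h2]

/-! ### Ruin -/

/-- Ruin decomposed according to the last record: this record lies at or above the initial capital,
and no further record is made. -/
lemma hasSum_ruinProb [IsProbabilityMeasure P] (hY : ∀ i, Measurable (Y i)) (hindep : iIndepFun Y P)
    (hident : ∀ i, IdentDistrib (Y i) (Y 0) P P)
    (hint : Integrable (fun ω => (Y 0 ω : ℝ)) P) (hprofit : meanClaim P Y < 1) (u : ℕ) :
    HasSum (fun k => (1 - meanClaim P Y) * P.real (recordIn Y (k + 1) (Set.Ici (u : ℤ))))
      (ruinProb P Y u) := by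
  let D (k : ℕ) : Set Ω :=
    recordIn Y (k + 1) (Set.Ici (u : ℤ)) \ {ω | recordTime Y (k + 2) ω < ⊤}
  have htop (k : ℕ) : MeasurableSet {ω | recordTime Y k ω < ⊤} := by
    simpa [recordIn] using measurableSet_recordIn hY k Set.univ
  have hD (k : ℕ) : MeasurableSet (D k) := (measurableSet_recordIn hY _ _).diff (htop _)
  have hdisj : Pairwise (Function.onFun Disjoint D) := by
    rw [pairwise_disjoint_on]
    exact fun k l hkl => Set.disjoint_left.2 fun ω h1 h2 =>
      h1.2 (surplus_recordTime_mono Y (show k + 2 ≤ l + 1 by omega) h2.1.1).1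
  have hmean : 0 ≤ meanClaim P Y := integral_nonneg fun ω => Nat.cast_nonneg _
  have hruin : ruinProb P Y u = (∑' k, P (D k)).toReal := by
    rw [← measure_iUnion hdisj hD, ruinProb, Measure.real]
    congr 1
    refine measure_congr ?_
    filter_upwards [ae_eventually_surplus_neg hindep hident hint hprofit] with ω hω
    refine propext (Iff.trans (ruinTime_lt_top_iff_record Y u ω) (Iff.symm ?_))
    refine Set.mem_iUnion.trans ⟨fun ⟨k, h, _⟩ => ⟨k, h⟩, fun ⟨k, h⟩ => ?_⟩
    -- There are only finitely many records, as the surplus is nonnegative at each of them.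
    have hfin : ∃ n, ¬ recordTime Y (n + 2) ω < ⊤ := by
      by_contra! hall
      obtain ⟨N, hN⟩ := Filter.eventually_atTop.1 hω
      obtain ⟨r, hr⟩ := (recordTime_lt_top_iff Y _ ω).1 (hall N)
      have h1 := surplus_recordTime_nonneg Y (hall N)
      have h2 := hN r (by have := le_recordTime Y hr; omega)
      simp only [hr, ENat.toNat_natCast] at h1
      omega
    obtain ⟨n, hn, hmin⟩ : ∃ n, ¬ recordTime Y (n + 2) ω < ⊤ ∧
        ∀ m < n, recordTime Y (m + 2) ω < ⊤ := by
      classical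
      exact ⟨Nat.find hfin, Nat.find_spec hfin, fun m hm => not_not.1 (Nat.find_min hfin hm)⟩
    have hkn : k ≤ n := by
      by_contra! hlt
      exact hn (surplus_recordTime_mono Y (by omega) h.1).1
    have hlast : recordTime Y (n + 1) ω < ⊤ := by
      obtain h0 | h0 := Nat.eq_zero_or_pos (n)
      · rw [show n = k by omega]
        exact h.1
      · have := hmin (n - 1) (by omega)
        rwa [show n - 1 + 2 = n + 1 by omega] at this
    refine ⟨n, ⟨hlast, ?_⟩, hn⟩
    exact h.2.trans (surplus_recordTime_mono Y (by omega) hlast).2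
  have hterm (k : ℕ) : (1 - meanClaim P Y) * P.real (recordIn Y (k + 1) (Set.Ici (u : ℤ))) =
      (P (D k)).toReal := by
    have h1 := measureReal_inter_add_sdiff (μ := P) (s := recordIn Y (k + 1) (Set.Ici (u : ℤ)))
      (htop (k + 2))
    have h2 := congrArg ENNReal.toReal (measure_recordIn_inter_succ hY hindep hident hint hprofit
      (k + 1) (Set.Ici (u : ℤ)))
    rw [ENNReal.toReal_mul, ENNReal.toReal_ofReal hmean] at h2
    simp only [Measure.real, D] at h1 ⊢
    linarith
  rw [hruin, ENNReal.tsum_toReal_eq fun k => measure_ne_top P _]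
  simp_rw [hterm]
  exact ENNReal.hasSum_toReal ((measure_iUnion hdisj hD).symm.trans_ne (measure_ne_top P _))

end Law

/-! ### Sums of equilibrium variables -/

section Equilibrium

variable {Ω : Type*} [MeasurableSpace Ω] {P : Measure Ω} {Y : ℕ → Ω → ℕ}
  {Ω' : Type*} [MeasurableSpace Ω'] {P' : Measure Ω'}
  {X : ℕ → Ω' → ℕ}

lemma measure_sum_succ_eq (hX : ∀ i, Measurable (X i)) (hindep : iIndepFun X P') (k s : ℕ) :
    P' {ω | ∑ i ∈ Finset.range (k + 1), X i ω = s} = ∑ j ∈ Finset.range (s + 1),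
      P' {ω | ∑ i ∈ Finset.range k, X i ω = j} * P' {ω | X k ω = s - j} := by
  have hS : Measurable fun ω => ∑ i ∈ Finset.range k, X i ω := by fun_prop
  have hind : IndepFun (fun ω => ∑ i ∈ Finset.range k, X i ω) (X k) P' := by
    simpa [Finset.sum_fn] using hindep.indepFun_sum_range_succ hX k
  have hunion : {ω | ∑ i ∈ Finset.range (k + 1), X i ω = s} = ⋃ j ∈ Finset.range (s + 1),
      {ω | ∑ i ∈ Finset.range k, X i ω = j} ∩ {ω | X k ω = s - j} := by
    ext ω
    simp only [Finset.sum_range_succ, Set.mem_iUnion, Set.mem_inter_iff, Set.mem_ofPred_eq,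
      exists_prop, Finset.mem_range]
    constructor
    · intro h
      exact ⟨_, by omega, rfl, by omega⟩
    · rintro ⟨j, hj, h1, h2⟩
      omega
  rw [hunion, measure_biUnion_finset]
  · refine Finset.sum_congr rfl fun j _ => ?_
    exact hind.measure_inter_preimage_eq_mul {j} {s - j} (.singleton _) (.singleton _)
  · exact fun i _ j _ hij => Set.disjoint_left.2 fun ω h1 h2 => hij (h1.1.symm.trans h2.1)
  · exact fun j _ => (hS (.singleton j)).inter (hX k (.singleton (s - j)))

/-- The claim tail is `μ` times the equilibrium distribution, also if `μ = 0`. -/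
lemma measure_lt_eq_mul [IsFiniteMeasure P] [IsFiniteMeasure P']
    (hY : ∀ i, Measurable (Y i))
    (hint : Integrable (fun ω => (Y 0 ω : ℝ)) P)
    (hX : ∀ i x, P'.real {ω | X i ω = x} = equilibriumProb P Y x) (i x : ℕ) :
    P {ω | x < Y 0 ω} = ENNReal.ofReal (meanClaim P Y) * P' {ω | X i ω = x} := by
  have hmean : 0 ≤ meanClaim P Y := integral_nonneg fun ω => Nat.cast_nonneg _
  obtain h0 | h0 := eq_or_ne (meanClaim P Y) 0
  · have h := ofReal_meanClaim (P := P) hY hint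
    rw [h0, ENNReal.ofReal_zero, eq_comm, ENNReal.tsum_eq_zero] at h
    rw [h x, h0, ENNReal.ofReal_zero, zero_mul]
  · rw [← ofReal_measureReal (μ := P'), hX, ← ENNReal.ofReal_mul hmean, equilibriumProb,
      mul_div_cancel₀ _ h0, claimTail, ofReal_measureReal]

lemma measure_recordIn_eq_mul (hY : ∀ i, Measurable (Y i)) (hindep : iIndepFun Y P)
    (hident : ∀ i, IdentDistrib (Y i) (Y 0) P P)
    (hint : Integrable (fun ω => (Y 0 ω : ℝ)) P) (hprofit : meanClaim P Y < 1)
    (hXm : ∀ i, Measurable (X i)) (hXindep : iIndepFun X P')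
    (hX : ∀ i x, P'.real {ω | X i ω = x} = equilibriumProb P Y x) (k s : ℕ) :
    P (recordIn Y k {(s : ℤ)}) = ENNReal.ofReal (meanClaim P Y) ^ k *
      P' {ω | ∑ i ∈ Finset.range k, X i ω = s} := by
  have := hindep.isProbabilityMeasure
  have := hXindep.isProbabilityMeasure
  induction k generalizing s with
  | zero =>
    rw [measure_recordIn_zero_singleton]
    by_cases h : s = 0
    · simp [h]
    · simp [h, Ne.symm h]
  | succ k ih =>
    rw [measure_recordIn_succ hY hindep hident hint hprofit, measure_sum_succ_eq hXm hXindep,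
      Finset.mul_sum]
    refine Finset.sum_congr rfl fun j _ => ?_
    rw [ih, measure_lt_eq_mul hY hint hX k]
    ring

/-- On the event that `k` records are made, the height of the `k`-th one is distributed as the sum
of `k` independent equilibrium variables. -/
lemma measure_recordIn_Ici_eq_mul (hY : ∀ i, Measurable (Y i)) (hindep : iIndepFun Y P)
    (hident : ∀ i, IdentDistrib (Y i) (Y 0) P P)
    (hint : Integrable (fun ω => (Y 0 ω : ℝ)) P) (hprofit : meanClaim P Y < 1)
    (hXm : ∀ i, Measurable (X i)) (hXindep : iIndepFun X P')
    (hX : ∀ i x, P'.real {ω | X i ω = x} = equilibriumProb P Y x) (k u : ℕ) :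
    P (recordIn Y k (Set.Ici (u : ℤ))) = ENNReal.ofReal (meanClaim P Y) ^ k *
      P' {ω | u ≤ ∑ i ∈ Finset.range k, X i ω} := by
  have hS : Measurable fun ω => ∑ i ∈ Finset.range k, X i ω := by fun_prop
  have h1 : recordIn Y k (Set.Ici (u : ℤ)) = ⋃ s : ℕ, recordIn Y k {((u + s : ℕ) : ℤ)} := by
    ext ω
    simp only [recordIn, Set.mem_ofPred_eq, Set.mem_iUnion, Set.mem_Ici, Set.mem_singleton_iff,
      exists_and_left]
    refine and_congr_right fun _ => ⟨fun h => ?_, fun ⟨s, h⟩ => by omega⟩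
    exact ⟨(surplus Y (recordTime Y k ω).toNat ω - u).toNat, by omega⟩
  have h2 : {ω | u ≤ ∑ i ∈ Finset.range k, X i ω} =
      ⋃ s : ℕ, {ω | ∑ i ∈ Finset.range k, X i ω = u + s} := by
    ext ω
    simp [le_iff_exists_add]
  rw [h1, h2, measure_iUnion ?_ fun s => measurableSet_recordIn hY _ _,
    measure_iUnion ?_ fun s => ?_, ← ENNReal.tsum_mul_left]
  · exact tsum_congr fun s =>
      measure_recordIn_eq_mul hY hindep hident hint hprofit hXm hXindep hX k (u + s)
  · refine fun s t hst => Set.disjoint_left.2 fun ω (h1 : _ = _) (h2 : _ = _) => hst ?_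
    omega
  · exact hS (.singleton (u + s))
  · refine fun s t hst => Set.disjoint_left.2 fun ω h1 h2 => hst ?_
    have h3 : _ = _ := h1.2
    have h4 : _ = _ := h2.2
    omega

end Equilibrium

end GerberDickson

theorem mainTheorem3 {Ω : Type*} [MeasurableSpace Ω] (P : Measure Ω) [IsProbabilityMeasure P]
    (Y : ℕ → Ω → ℕ) (hY : ∀ i, Measurable (Y i)) (hindep : iIndepFun Y P)
    (hident : ∀ i, IdentDistrib (Y i) (Y 0) P P)
    (hint : Integrable (fun ω => (Y 0 ω : ℝ)) P)
    (hprofit : GerberDickson.meanClaim P Y < 1) :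
    -- the formula for the record severities: the `k`-th term is conditional on `τ*_k < ∞`
    (∀ u : ℕ, HasSum
      (fun k : ℕ => (1 - GerberDickson.meanClaim P Y) *
        ((ProbabilityTheory.cond P {ω | GerberDickson.recordTime Y (k + 1) ω < ⊤}).real
          {ω | (u : ℤ) ≤ ∑ i ∈ Finset.range (k + 1), GerberDickson.recordSeverity Y i ω} *
        GerberDickson.meanClaim P Y ^ (k + 1)))
      (GerberDickson.ruinProb P Y u)) ∧
    -- the formula for any i.i.d. sequence with the equilibrium distribution
    (∀ {Ω' : Type*} [MeasurableSpace Ω'] (P' : Measure Ω') [IsProbabilityMeasure P']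
      (Ystar : ℕ → Ω' → ℕ), (∀ i, Measurable (Ystar i)) → iIndepFun Ystar P' →
      (∀ i x, P'.real {ω | Ystar i ω = x} = GerberDickson.equilibriumProb P Y x) →
      ∀ u : ℕ, HasSum
        (fun k : ℕ => (1 - GerberDickson.meanClaim P Y) *
          (P'.real {ω | u ≤ ∑ i ∈ Finset.range (k + 1), Ystar i ω} *
          GerberDickson.meanClaim P Y ^ (k + 1)))
        (GerberDickson.ruinProb P Y u)) := by
  have hmean : 0 ≤ GerberDickson.meanClaim P Y := integral_nonneg fun ω => Nat.cast_nonneg _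
  have hruin := GerberDickson.hasSum_ruinProb hY hindep hident hint hprofit
  constructor
  · intro u
    convert hruin u using 3 with k
    have htop : MeasurableSet {ω | GerberDickson.recordTime Y (k + 1) ω < ⊤} := by
      simpa [GerberDickson.recordIn] using
        GerberDickson.measurableSet_recordIn hY (k + 1) Set.univ
    have h := congrArg ENNReal.toReal (cond_mul_eq_inter htop
      {ω | (u : ℤ) ≤ ∑ i ∈ Finset.range (k + 1), GerberDickson.recordSeverity Y i ω} P)
    rw [GerberDickson.measure_recordTime_lt_top hY hindep hident hint hprofit, ENNReal.toReal_mul,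
      ENNReal.toReal_pow, ENNReal.toReal_ofReal hmean] at h
    simp only [GerberDickson.sum_recordSeverity] at h ⊢
    exact h
  · intro Ω' _ P' _ X hXm hXindep hX u
    convert hruin u using 3 with k
    rw [Measure.real, Measure.real, GerberDickson.measure_recordIn_Ici_eq_mul hY hindep hident hint
      hprofit hXm hXindep hX, ENNReal.toReal_mul, ENNReal.toReal_pow, ENNReal.toReal_ofReal hmean,
      mul_comm]
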